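/- Let $m,n\ge 1$, $n_0=\min\{m,n\}$, and for $A\in\mathbb M_{m\times n}(\mathbb C)$ let $\sigma(A)=(\sigma_1(A),\ldots,\sigma_{n_0}(A))$, $\sigma_1(A)\ge\cdots\ge\sigma_{n_0}(A)\ge 0$, be the vector of its singular values, counted with multiplicity. For $1\le p<\infty$ let $\|A\|_p=\big(\sum_{i=1}^{n_0}\sigma_i(A)^p\big)^{1/p}$ be the Schatten $p$-norm. Let $\mathcal M$ be a (real or complex) linear subspace of $\mathbb M_{m\times n}(\mathbb C)$ and let $A\in\mathbb M_{m\times n}(\mathbb C)$. For $1<p<\infty$ let $Y_p\in\mathcal M$ be the best approximation of $A$ from $\mathcal M$ in the Schatten $p$-norm, that is, $\|A-Y_p\|_p=\min_{X\in\mathcal M}\|A-X\|_p$, and put $R_p=A-Y_p$. Let $Y^{(st)}\in\mathcal M$ be the strict spectral approximation of $A$ from $\mathcal M$, that is, the vector $\sigma(A-Y^{(st)})$ is minimal in the lexicographic order among all vectors $\sigma(A-X)$ with $X\in\mathcal M$, and put $R^{(st)}=A-Y^{(st)}$. Let $\rho_1>\rho_2>\cdots>\rho_l$ be the distinct values among $\sigma_1(R^{(st)}),\ldots,\sigma_{n_0}(R^{(st)})$,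 let $s_k$ be the multiplicity of $\rho_k$ among them, and let $t_k=s_1+\cdots+s_k$. **Theorem.** Suppose that $l\ge 2$ and $s_1=1$. Then for every $i=t_1+1,t_1+2,\ldots,t_2$, $$\lim_{p\to\infty}\sigma_i(R_p)=\sigma_i(R^{(st)})=\rho_2 .$$ -/

import Mathlib

open Filter Topology

namespace Matrix

/-- The vector `σ(A) = (σ₁(A), …, σ_{n₀}(A))`, `n₀ = min m n`, of singular values of the complex
`m × n` matrix `A` in non-increasing order, with multiplicities. The index starts at `0`:
`A.singularValueVec i` is the singular value that is usually written `σ_{i+1}(A)`. -/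
noncomputable def singularValueVec {m n : ℕ} (A : Matrix (Fin m) (Fin n) ℂ) :
    Fin (min m n) → ℝ :=
  fun i => (Matrix.toEuclideanLin A).singularValues (i : ℕ)

/-- The Schatten `p`-norm (the `c_p`-norm), for `1 ≤ p < ∞`. -/
noncomputable def schattenNorm {m n : ℕ} (p : ℝ) (A : Matrix (Fin m) (Fin n) ℂ) : ℝ :=
  (∑ i, A.singularValueVec i ^ p) ^ (1 / p)

/-- `Y` is a best approximation of `A` from the subspace `M` in the Schatten `p`-norm. -/
def IsSchattenApprox {m n : ℕ} (p : ℝ) (M : Submodule ℝ (Matrix (Fin m) (Fin n) ℂ))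
    (A Y : Matrix (Fin m) (Fin n) ℂ) : Prop :=
  Y ∈ M ∧ ∀ X ∈ M, schattenNorm p (A - Y) ≤ schattenNorm p (A - X)

/-- `Y` is a strict spectral approximation of `A` from the subspace `M`: the singular value vector
`σ(A - Y)` is minimal in the lexicographic order among all `σ(A - X)`, `X ∈ M`. -/
def IsStrictSpectralApprox {m n : ℕ} (M : Submodule ℝ (Matrix (Fin m) (Fin n) ℂ))
    (A Y : Matrix (Fin m) (Fin n) ℂ) : Prop :=
  Y ∈ M ∧ ∀ X ∈ M, toLex (A - Y).singularValueVec ≤ toLex (A - X).singularValueVec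

/-- The set `{ρ₁, …, ρ_l}` of the distinct singular values among `σ₁(R), …, σ_{n₀}(R)`. -/
noncomputable def distinctSingularValues {m n : ℕ} (R : Matrix (Fin m) (Fin n) ℂ) : Finset ℝ :=
  Finset.univ.image R.singularValueVec

/-- The number `l` of distinct singular values. -/
noncomputable def numDistinct {m n : ℕ} (R : Matrix (Fin m) (Fin n) ℂ) : ℕ :=
  R.distinctSingularValues.card

/-- The distinct singular values in decreasing order `ρ₁ > ρ₂ > ⋯ > ρ_l`. The index starts at `0`:
`R.rho ⟨0, _⟩` is `ρ₁`, and `R.rho ⟨1, _⟩` is `ρ₂`. -/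
noncomputable def rho {m n : ℕ} (R : Matrix (Fin m) (Fin n) ℂ) (k : Fin R.numDistinct) : ℝ :=
  R.distinctSingularValues.orderEmbOfFin rfl k.rev

/-- The multiplicity of a distinct singular value among `σ₁(R), …, σ_{n₀}(R)`. The index starts at
`0`: `R.rhoMult ⟨0, _⟩` is the multiplicity `s₁` of `ρ₁`. -/
noncomputable def rhoMult {m n : ℕ} (R : Matrix (Fin m) (Fin n) ℂ) (k : Fin R.numDistinct) : ℕ :=
  (Finset.univ.filter fun i => R.singularValueVec i = R.rho k).card

/-- `t_k = s₁ + ⋯ + s_k`, the sum of the first `k` multiplicities. -/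
noncomputable def rhoMultSum {m n : ℕ} (R : Matrix (Fin m) (Fin n) ℂ) (k : ℕ) : ℕ :=
  ∑ j ∈ Finset.univ.filter (fun j : Fin R.numDistinct => (j : ℕ) < k), R.rhoMult j

end Matrix

/-!
By Ky Fan's maximum principle, `σ₁ + ⋯ + σ_k` is a maximum of linear functionals, hence convex.
Along the segment from `R_p` to `R^(st)` the singular values are therefore weakly majorized by the
interpolated singular values of the endpoints, and comparing `∑ σ_i ^ p` at first order gives
`∑ σ_i(R_p) ^ (p - 1) * (σ_i(R^(st)) - σ_i(R_p)) ≥ 0`.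

Suppose that `σ_j(R_p) ≥ σ_j(R^(st))` whenever `σ_j(R^(st)) > σ_i(R^(st))`. Then all terms of this
sum are at most `σ_i(R^(st)) ^ p`, while the `i`-th one would be a much larger negative number if
`σ_i(R_p)` stayed above `σ_i(R^(st)) + ε`; so `limsup σ_i(R_p) ≤ σ_i(R^(st))`. Lexicographic
minimality yields the supposition for `j = 1`; this is where the simplicity of `ρ₁` enters.
Lastly, a cluster point of `R_p` competes with `R^(st)` in the lexicographic order and its first `i`
singular values do not exceed those of `R^(st)`, so they are equal to them.
-/

section BesselFamily

variable (𝕜 : Type*) {V ι : Type*} [RCLike 𝕜] [NormedAddCommGroup V] [InnerProductSpace 𝕜 V]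
  [Fintype ι]

/-- A finite family of vectors for which Bessel's inequality holds. Ky Fan's principle is stated for
such families rather than for orthonormal ones because the left singular vectors that belong to the
singular value `0` have to be allowed to vanish. -/
def IsBesselFamily (u : ι → V) : Prop :=
  ∀ x : V, ∑ i, ‖inner 𝕜 (u i) x‖ ^ 2 ≤ ‖x‖ ^ 2

variable {𝕜} {u : ι → V}

namespace IsBesselFamily

theorem of_pairwise_inner_eq_zero (hnorm : ∀ i, ‖u i‖ ≤ 1)
    (horth : Pairwise fun i j => inner 𝕜 (u i) (u j) = 0) : IsBesselFamily 𝕜 u := by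
  classical
  intro x
  set S := ∑ i, ‖inner 𝕜 (u i) x‖ ^ 2
  set y := ∑ i, inner 𝕜 (u i) x • u i
  have inner_u_y (i : ι) : inner 𝕜 (u i) y = inner 𝕜 (u i) x * (‖u i‖ : 𝕜) ^ 2 := by
    rw [inner_sum, Finset.sum_eq_single i (fun j _ hji => by
      rw [inner_smul_right, horth hji.symm, mul_zero]) (by simp), inner_smul_right,
      inner_self_eq_norm_sq_to_K]
  have re_inner_y_x : RCLike.re (inner 𝕜 y x) = S := by
    simp only [y, S, sum_inner, inner_smul_left, RCLike.conj_mul, map_sum]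
    norm_cast
  have norm_sq_y_le : ‖y‖ ^ 2 ≤ S := by
    have norm_sq_y : ‖y‖ ^ 2 = ∑ i, ‖inner 𝕜 (u i) x‖ ^ 2 * ‖u i‖ ^ 2 := by
      rw [← inner_self_eq_norm_sq (𝕜 := 𝕜)]
      nth_rewrite 1 [show y = ∑ i, inner 𝕜 (u i) x • u i from rfl]
      simp only [sum_inner, inner_smul_left, inner_u_y, ← mul_assoc, RCLike.conj_mul, map_sum]
      norm_cast
    rw [norm_sq_y]
    exact Finset.sum_le_sum fun i _ =>
      mul_le_of_le_one_right (sq_nonneg _) (pow_le_one₀ (norm_nonneg _) (hnorm i))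
  have norm_sub_sq := norm_sub_sq (𝕜 := 𝕜) y x
  linarith [sq_nonneg ‖y - x‖]

theorem of_orthonormal (hu : Orthonormal 𝕜 u) : IsBesselFamily 𝕜 u :=
  of_pairwise_inner_eq_zero (fun i => (hu.1 i).le) hu.2

theorem of_subsingleton [Subsingleton ι] (hu : ∀ i, ‖u i‖ ≤ 1) : IsBesselFamily 𝕜 u :=
  of_pairwise_inner_eq_zero hu Subsingleton.pairwise

theorem norm_le_one (hu : IsBesselFamily 𝕜 u) (i : ι) : ‖u i‖ ≤ 1 := by
  have h : ‖inner 𝕜 (u i) (u i)‖ ^ 2 ≤ ‖u i‖ ^ 2 :=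
    (Finset.single_le_sum (f := fun j => ‖inner 𝕜 (u j) (u i)‖ ^ 2)
      (fun j _ => sq_nonneg _) (Finset.mem_univ i)).trans (hu (u i))
  rw [inner_self_eq_norm_sq_to_K, norm_pow, RCLike.norm_ofReal, abs_norm] at h
  by_contra! hlt
  nlinarith [mul_pos (sub_pos.2 hlt) (sub_pos.2 hlt)]

theorem comp {κ : Type*} [Fintype κ] {g : κ → ι} (hu : IsBesselFamily 𝕜 u)
    (hg : Function.Injective g) : IsBesselFamily 𝕜 (u ∘ g) := fun x =>
  calc ∑ k, ‖inner 𝕜 (u (g k)) x‖ ^ 2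
      = ∑ i ∈ Finset.univ.map ⟨g, hg⟩, ‖inner 𝕜 (u i) x‖ ^ 2 := by
        rw [Finset.sum_map, Function.Embedding.coeFn_mk]
    _ ≤ ∑ i, ‖inner 𝕜 (u i) x‖ ^ 2 := Finset.sum_le_univ_sum_of_nonneg fun _ => sq_nonneg _
    _ ≤ ‖x‖ ^ 2 := hu x

end IsBesselFamily

end BesselFamily

section SingularValueDecomposition

open Module

variable {𝕜 E F : Type*} [RCLike 𝕜] [NormedAddCommGroup E] [InnerProductSpace 𝕜 E]
  [FiniteDimensional 𝕜 E] [NormedAddCommGroup F] [InnerProductSpace 𝕜 F] [FiniteDimensional 𝕜 F]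

/-- The right singular vectors of `T`: an orthonormal eigenbasis of `T† T`, ordered by decreasing
singular value. -/
noncomputable def rightSingularBasis (T : E →ₗ[𝕜] F) :
    OrthonormalBasis (Fin (finrank 𝕜 E)) 𝕜 E :=
  T.isSymmetric_adjoint_comp_self.eigenvectorBasis rfl

/-- The left singular vectors of `T`. Since `0⁻¹ = 0`, those that belong to the singular value `0`
are `0`. -/
noncomputable def leftSingularVector (T : E →ₗ[𝕜] F) (j : Fin (finrank 𝕜 E)) : F :=
  (T.singularValues j : 𝕜)⁻¹ • T (rightSingularBasis T j)

variable (T : E →ₗ[𝕜] F)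

theorem inner_apply_rightSingularBasis (i j : Fin (finrank 𝕜 E)) :
    inner 𝕜 (T (rightSingularBasis T i)) (T (rightSingularBasis T j)) =
      (T.singularValues j : 𝕜) ^ 2 *
        inner 𝕜 (rightSingularBasis T i) (rightSingularBasis T j) := by
  have happly := T.isSymmetric_adjoint_comp_self.apply_eigenvectorBasis rfl j
  rw [LinearMap.comp_apply, ← T.sq_singularValues_fin rfl j, RCLike.ofReal_pow] at happly
  rw [← LinearMap.adjoint_inner_right, rightSingularBasis, happly, inner_smul_right]

theorem norm_apply_rightSingularBasis (j : Fin (finrank 𝕜 E)) :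
    ‖T (rightSingularBasis T j)‖ = T.singularValues j := by
  have h := inner_apply_rightSingularBasis T j j
  rw [inner_self_eq_norm_sq_to_K, inner_self_eq_norm_sq_to_K,
    (rightSingularBasis T).norm_eq_one, RCLike.ofReal_one, one_pow, mul_one] at h
  exact (pow_left_inj₀ (norm_nonneg _) (T.singularValues_nonneg _) two_ne_zero).1
    (by exact_mod_cast h)

theorem apply_rightSingularBasis (j : Fin (finrank 𝕜 E)) :
    T (rightSingularBasis T j) = (T.singularValues j : 𝕜) • leftSingularVector T j := by
  by_cases h : T.singularValues j = 0
  · rw [h, RCLike.ofReal_zero, zero_smul, ← norm_eq_zero, norm_apply_rightSingularBasis, h]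
  · rw [leftSingularVector, smul_inv_smul₀ (RCLike.ofReal_ne_zero.2 h)]

theorem inner_leftSingularVector_apply_rightSingularBasis (j : Fin (finrank 𝕜 E)) :
    inner 𝕜 (leftSingularVector T j) (T (rightSingularBasis T j)) = (T.singularValues j : 𝕜) := by
  rw [leftSingularVector, inner_smul_left, inner_self_eq_norm_sq_to_K,
    norm_apply_rightSingularBasis, map_inv₀ (starRingEnd 𝕜), RCLike.conj_ofReal, pow_two,
    ← mul_assoc, inv_mul_mul_self]

theorem isBesselFamily_leftSingularVector : IsBesselFamily 𝕜 (leftSingularVector T) := by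
  refine .of_pairwise_inner_eq_zero (fun j => ?_) fun i j hij => ?_
  · rw [leftSingularVector, norm_smul, norm_apply_rightSingularBasis, norm_inv,
      RCLike.norm_ofReal, abs_of_nonneg (T.singularValues_nonneg _)]
    exact inv_mul_le_one
  · simp only [leftSingularVector, inner_smul_left, inner_smul_right,
      inner_apply_rightSingularBasis, (rightSingularBasis T).orthonormal.2 hij, mul_zero]

theorem apply_eq_sum_singularValues_smul (x : E) :
    T x = ∑ j : Fin (finrank 𝕜 E), inner 𝕜 (rightSingularBasis T j) x •
      (T.singularValues j : 𝕜) • leftSingularVector T j := by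
  conv_lhs => rw [← (rightSingularBasis T).sum_repr' x, map_sum]
  simp only [map_smul, apply_rightSingularBasis]

end SingularValueDecomposition

section Sums

/-- A fractional selection `w` of total weight at most `k` gains `σ j - σ k` at most for each
`j < k` over the constant `σ k`, and nothing for `k ≤ j`. -/
theorem sum_mul_le_sum_range_of_antitone {σ : ℕ → ℝ} (hσ : Antitone σ) {N k : ℕ} (hσk : 0 ≤ σ k)
    {w : Fin N → ℝ} (hw₀ : ∀ j, 0 ≤ w j) (hw₁ : ∀ j, w j ≤ 1) (hw : ∑ j, w j ≤ k) :
    ∑ j : Fin N, σ j * w j ≤ ∑ j ∈ Finset.range k, σ j := by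
  have hterm (j : Fin N) : σ j * w j ≤ σ k * w j + max (σ j - σ k) 0 := by
    nlinarith [mul_le_mul_of_nonneg_right (le_max_left (σ j - σ k) 0) (hw₀ j),
      mul_le_mul_of_nonneg_left (hw₁ j) (le_max_right (σ j - σ k) 0)]
  have hexcess : ∑ j : Fin N, max (σ j - σ k) 0 ≤ ∑ j ∈ Finset.range k, (σ j - σ k) :=
    calc ∑ j : Fin N, max (σ j - σ k) 0
        = ∑ j ∈ Finset.range N with j < k, max (σ j - σ k) 0 := by
          rw [Fin.sum_univ_eq_sum_range fun j => max (σ j - σ k) 0, Finset.sum_filter_of_ne]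
          intro j _ hne
          by_contra! hkj
          exact hne (max_eq_right (sub_nonpos.2 (hσ hkj)))
      _ ≤ ∑ j ∈ Finset.range k, max (σ j - σ k) 0 :=
          Finset.sum_le_sum_of_subset_of_nonneg (fun j hj => by simp_all)
            fun _ _ _ => le_max_right _ _
      _ = ∑ j ∈ Finset.range k, (σ j - σ k) :=
          Finset.sum_congr rfl fun j hj =>
            max_eq_left (sub_nonneg.2 (hσ (Finset.mem_range.1 hj).le))
  calc ∑ j : Fin N, σ j * w j
      ≤ σ k * ∑ j, w j + ∑ j : Fin N, max (σ j - σ k) 0 := by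
        rw [Finset.mul_sum, ← Finset.sum_add_distrib]
        exact Finset.sum_le_sum fun j _ => hterm j
    _ ≤ σ k * k + ∑ j ∈ Finset.range k, (σ j - σ k) := by gcongr
    _ = ∑ j ∈ Finset.range k, σ j := by
        rw [Finset.sum_sub_distrib, Finset.sum_const, Finset.card_range, nsmul_eq_mul]
        ring

theorem sum_mul_nonneg_of_antitone_of_partial_sums_nonneg {w d : ℕ → ℝ} (hw : Antitone w)
    (hw₀ : ∀ i, 0 ≤ w i) {N : ℕ} (hd : ∀ k ≤ N, 0 ≤ ∑ i ∈ Finset.range k, d i) :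
    0 ≤ ∑ i ∈ Finset.range N, w i * d i := by
  suffices ∀ k ≤ N, w k * ∑ i ∈ Finset.range k, d i ≤ ∑ i ∈ Finset.range k, w i * d i from
    (mul_nonneg (hw₀ N) (hd N le_rfl)).trans (this N le_rfl)
  intro k hk
  induction k with
  | zero => simp
  | succ k ih =>
    calc w (k + 1) * ∑ i ∈ Finset.range (k + 1), d i
        ≤ w k * ∑ i ∈ Finset.range (k + 1), d i :=
          mul_le_mul_of_nonneg_right (hw k.le_succ) (hd _ hk)
      _ = w k * ∑ i ∈ Finset.range k, d i + w k * d k := by rw [Finset.sum_range_succ, mul_add]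
      _ ≤ ∑ i ∈ Finset.range (k + 1), w i * d i := by
          rw [Finset.sum_range_succ]
          gcongr
          exact ih (k.le_succ.trans hk)

theorem rpow_add_mul_sub_le_rpow {x y p : ℝ} (hx : 0 ≤ x) (hy : 0 ≤ y) (hp : 1 ≤ p) :
    y ^ p + p * y ^ (p - 1) * (x - y) ≤ x ^ p := by
  have hderiv := Real.hasDerivAt_rpow_const (x := y) (Or.inr hp)
  rcases lt_trichotomy x y with hxy | rfl | hxy
  · have := (convexOn_rpow hp).slope_le_of_hasDerivAt hx hy hxy hderiv
    rw [slope_def_field, div_le_iff₀ (sub_pos.2 hxy)] at this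
    linarith
  · simp
  · have := (convexOn_rpow hp).le_slope_of_hasDerivAt hy hx hxy hderiv
    rw [slope_def_field, le_div_iff₀ (sub_pos.2 hxy)] at this
    linarith

/-- The power case of the Tomić–Weyl theorem on weak majorization. -/
theorem sum_rpow_le_sum_rpow_of_partial_sums_le {b c : ℕ → ℝ} (hb : ∀ i, 0 ≤ b i)
    (hc : Antitone c) (hc₀ : ∀ i, 0 ≤ c i) {N : ℕ} {p : ℝ} (hp : 1 ≤ p)
    (h : ∀ k ≤ N, ∑ i ∈ Finset.range k, c i ≤ ∑ i ∈ Finset.range k, b i) :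
    ∑ i ∈ Finset.range N, c i ^ p ≤ ∑ i ∈ Finset.range N, b i ^ p := by
  have hsum : 0 ≤ ∑ i ∈ Finset.range N, p * c i ^ (p - 1) * (b i - c i) := by
    refine sum_mul_nonneg_of_antitone_of_partial_sums_nonneg (fun i j hij => ?_) (fun i => ?_)
      fun k hk => ?_
    · have := Real.rpow_le_rpow (hc₀ j) (hc hij) (sub_nonneg.2 hp)
      gcongr
    · have := Real.rpow_nonneg (hc₀ i) (p - 1)
      positivity
    · rw [Finset.sum_sub_distrib]
      exact sub_nonneg.2 (h k hk)
  calc ∑ i ∈ Finset.range N, c i ^ p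
      ≤ ∑ i ∈ Finset.range N, (c i ^ p + p * c i ^ (p - 1) * (b i - c i)) := by
        rw [Finset.sum_add_distrib]
        exact le_add_of_nonneg_right hsum
    _ ≤ ∑ i ∈ Finset.range N, b i ^ p :=
        Finset.sum_le_sum fun i _ => rpow_add_mul_sub_le_rpow (hb i) (hc₀ i) hp

variable {ι : Type*} {s : Finset ι}

theorem sum_rpow_sub_one_mul_sub_nonneg_of_segment {a b : ι → ℝ} {p : ℝ} (hp : 1 ≤ p)
    (h : ∀ t ∈ Set.Icc (0 : ℝ) 1,
      ∑ i ∈ s, a i ^ p ≤ ∑ i ∈ s, ((1 - t) * a i + t * b i) ^ p) :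
    0 ≤ ∑ i ∈ s, a i ^ (p - 1) * (b i - a i) := by
  have hderiv : HasDerivAt (fun t : ℝ => ∑ i ∈ s, ((1 - t) * a i + t * b i) ^ p)
      (p * ∑ i ∈ s, a i ^ (p - 1) * (b i - a i)) 0 := by
    rw [Finset.mul_sum]
    refine HasDerivAt.fun_sum fun i _ => ?_
    have hline : HasDerivAt (fun t : ℝ => (1 - t) * a i + t * b i) (b i - a i) 0 := by
      convert! (((hasDerivAt_id (0 : ℝ)).const_sub 1).mul_const (a i)).add
        ((hasDerivAt_id (0 : ℝ)).mul_const (b i)) using 1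
      ring
    convert! hline.rpow_const (p := p) (Or.inr hp) using 1
    simp only [sub_zero, one_mul, zero_mul, add_zero]
    ring
  have hmin : IsLocalMinOn (fun t : ℝ => ∑ i ∈ s, ((1 - t) * a i + t * b i) ^ p)
      (Set.Icc 0 1) 0 :=
    IsMinOn.localize (isMinOn_iff.2 fun t ht => by simpa using h t ht)
  have hcone : (1 : ℝ) ∈ posTangentConeAt (Set.Icc 0 1) 0 :=
    mem_posTangentConeAt_of_segment_subset (by simp [segment_eq_Icc])
  have hnonneg := hmin.hasFDerivWithinAt_nonneg hderiv.hasFDerivAt.hasFDerivWithinAt hcone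
  exact nonneg_of_mul_nonneg_right (by simpa using hnonneg) (by linarith)

/-- The terms with `b j ≤ a j` are nonpositive, and the others satisfy `a j < b j ≤ b i`. -/
theorem rpow_sub_one_mul_sub_le_card_mul {a b : ι → ℝ} (ha : ∀ j, 0 ≤ a j) (hb : ∀ j, 0 ≤ b j)
    {i : ι} (hi : i ∈ s) (hlt : ∀ j ∈ s, b i < b j → b j ≤ a j) {p : ℝ} (hp : 1 ≤ p)
    (h : 0 ≤ ∑ j ∈ s, a j ^ (p - 1) * (b j - a j)) :
    a i ^ (p - 1) * (a i - b i) ≤ s.card * (b i ^ (p - 1) * b i) := by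
  classical
  have hC : 0 ≤ b i ^ (p - 1) * b i := mul_nonneg (Real.rpow_nonneg (hb i) _) (hb i)
  have hterm : ∀ j ∈ s, a j ^ (p - 1) * (b j - a j) ≤ b i ^ (p - 1) * b i := fun j hj => by
    rcases le_or_gt (b j) (a j) with hba | hab
    · exact (mul_nonpos_of_nonneg_of_nonpos (Real.rpow_nonneg (ha j) _) (by linarith)).trans hC
    · have hji : b j ≤ b i := not_lt.1 fun hij => (hlt j hj hij).not_gt hab
      exact mul_le_mul (Real.rpow_le_rpow (ha j) (by linarith) (by linarith)) (by linarith [ha j])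
        (by linarith) (Real.rpow_nonneg (hb i) _)
  have herase : ∑ j ∈ s.erase i, a j ^ (p - 1) * (b j - a j) ≤
      s.card * (b i ^ (p - 1) * b i) :=
    calc ∑ j ∈ s.erase i, a j ^ (p - 1) * (b j - a j)
        ≤ (s.erase i).card • (b i ^ (p - 1) * b i) :=
          Finset.sum_le_card_nsmul _ _ _ fun j hj => hterm j (Finset.mem_of_mem_erase hj)
      _ ≤ s.card * (b i ^ (p - 1) * b i) := by
          rw [nsmul_eq_mul]
          gcongr
          exact Finset.erase_subset i s
  rw [← Finset.add_sum_erase s _ hi] at h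
  linarith

theorem eventually_lt_add_of_sum_rpow_sub_one_mul_sub_nonneg {a : ℝ → ι → ℝ} {b : ι → ℝ}
    (ha : ∀ p j, 0 ≤ a p j) (hb : ∀ j, 0 ≤ b j) {i : ι} (hi : i ∈ s)
    (hlt : ∀ᶠ p in atTop, ∀ j ∈ s, b i < b j → b j ≤ a p j)
    (h : ∀ᶠ p in atTop, 0 ≤ ∑ j ∈ s, a p j ^ (p - 1) * (b j - a p j)) {ε : ℝ} (hε : 0 < ε) :
    ∀ᶠ p in atTop, a p i < b i + ε := by
  have hpos : 0 < b i + ε := by linarith [hb i]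
  have hlim : Tendsto (fun p : ℝ => s.card * b i * (b i / (b i + ε)) ^ (p - 1)) atTop
      (𝓝 (s.card * b i * 0)) := by
    refine ((tendsto_rpow_atTop_of_base_lt_one _ ?_ ?_).comp
      (tendsto_atTop_add_const_right _ (-1) tendsto_id)).const_mul _
    · linarith [div_nonneg (hb i) hpos.le]
    · exact (div_lt_one hpos).2 (by linarith)
  rw [mul_zero] at hlim
  filter_upwards [hlim.eventually_lt_const hε, hlt, h, eventually_ge_atTop 1]
    with p hsmall hltp hsum hp
  by_contra! hge
  have hbound :=
    calc (b i + ε) ^ (p - 1) * ε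
        ≤ a p i ^ (p - 1) * (a p i - b i) :=
          mul_le_mul (Real.rpow_le_rpow hpos.le hge (by linarith)) (by linarith) hε.le
            (Real.rpow_nonneg (ha p i) _)
      _ ≤ s.card * (b i ^ (p - 1) * b i) :=
          rpow_sub_one_mul_sub_le_card_mul (ha p) hb hi hltp hp hsum
  rw [Real.div_rpow (hb i) hpos.le, ← mul_div_assoc,
    div_lt_iff₀ (Real.rpow_pos_of_pos hpos _)] at hsmall
  linarith

end Sums

section KyFan

open Module

variable {𝕜 E F : Type*} [RCLike 𝕜] [NormedAddCommGroup E] [InnerProductSpace 𝕜 E]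
  [FiniteDimensional 𝕜 E] [NormedAddCommGroup F] [InnerProductSpace 𝕜 F] [FiniteDimensional 𝕜 F]

/-- The Ky Fan `k`-norm: the sum of the `k` largest singular values. -/
noncomputable def kyFanNorm (k : ℕ) (T : E →ₗ[𝕜] F) : ℝ :=
  ∑ i ∈ Finset.range k, T.singularValues i

theorem sum_norm_inner_sq_le_card {V ι κ : Type*} [NormedAddCommGroup V] [InnerProductSpace 𝕜 V]
    [Fintype ι] [Fintype κ] {u : ι → V} {e : κ → V} (hu : ∀ i, ‖u i‖ ≤ 1)
    (he : IsBesselFamily 𝕜 e) :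
    ∑ j, ∑ i, ‖inner 𝕜 (u i) (e j)‖ ^ 2 ≤ Fintype.card ι := by
  rw [Finset.sum_comm]
  calc ∑ i, ∑ j, ‖inner 𝕜 (u i) (e j)‖ ^ 2
      ≤ ∑ _i : ι, (1 : ℝ) := Finset.sum_le_sum fun i _ => by
        simp only [norm_inner_symm (u i)]
        exact (he (u i)).trans (pow_le_one₀ (norm_nonneg _) (hu i))
    _ = Fintype.card ι := by simp

theorem re_inner_apply_le_sum (T : E →ₗ[𝕜] F) (u : F) (v : E) :
    RCLike.re (inner 𝕜 u (T v)) ≤ ∑ j : Fin (finrank 𝕜 E), T.singularValues j *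
      ((‖inner 𝕜 u (leftSingularVector T j)‖ ^ 2 +
        ‖inner 𝕜 v (rightSingularBasis T j)‖ ^ 2) / 2) := by
  rw [apply_eq_sum_singularValues_smul T v, inner_sum, map_sum]
  refine Finset.sum_le_sum fun j _ => (RCLike.re_le_norm _).trans ?_
  rw [inner_smul_right, inner_smul_right, norm_mul, norm_mul, RCLike.norm_ofReal,
    abs_of_nonneg (T.singularValues_nonneg _), norm_inner_symm (rightSingularBasis T j) v]
  have hmul := two_mul_le_add_sq ‖inner 𝕜 u (leftSingularVector T j)‖
    ‖inner 𝕜 v (rightSingularBasis T j)‖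
  nlinarith [mul_le_mul_of_nonneg_left hmul (T.singularValues_nonneg j)]

/-- One half of Ky Fan's maximum principle; the other is `exists_kyFanNorm_eq_sum_re_inner`. -/
theorem sum_re_inner_le_kyFanNorm {ι : Type*} [Fintype ι] {k : ℕ} (hk : Fintype.card ι ≤ k)
    {u : ι → F} {v : ι → E} (hu : IsBesselFamily 𝕜 u) (hv : IsBesselFamily 𝕜 v)
    (T : E →ₗ[𝕜] F) :
    ∑ i, RCLike.re (inner 𝕜 (u i) (T (v i))) ≤ kyFanNorm k T := by
  have he := isBesselFamily_leftSingularVector T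
  have hf := IsBesselFamily.of_orthonormal (rightSingularBasis T).orthonormal
  let w (j : Fin (finrank 𝕜 E)) : ℝ := ∑ i, (‖inner 𝕜 (u i) (leftSingularVector T j)‖ ^ 2 +
    ‖inner 𝕜 (v i) (rightSingularBasis T j)‖ ^ 2) / 2
  have hw_eq (j) : w j = (∑ i, ‖inner 𝕜 (u i) (leftSingularVector T j)‖ ^ 2 +
      ∑ i, ‖inner 𝕜 (v i) (rightSingularBasis T j)‖ ^ 2) / 2 := by
    rw [← Finset.sum_add_distrib, Finset.sum_div]
  have hw_nonneg (j) : 0 ≤ w j := Finset.sum_nonneg fun i _ => by positivity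
  have hw_le_one (j) : w j ≤ 1 := by
    have hu_le := (hu (leftSingularVector T j)).trans
      (pow_le_one₀ (norm_nonneg _) (he.norm_le_one j))
    have hv_le := (hv (rightSingularBasis T j)).trans
      (pow_le_one₀ (norm_nonneg _) (hf.norm_le_one j))
    rw [hw_eq]
    linarith
  have hw_sum : ∑ j, w j ≤ k := by
    have hu_sum := sum_norm_inner_sq_le_card hu.norm_le_one he
    have hv_sum := sum_norm_inner_sq_le_card hv.norm_le_one hf
    have hk' : (Fintype.card ι : ℝ) ≤ k := by exact_mod_cast hk
    simp only [hw_eq, ← Finset.sum_div, Finset.sum_add_distrib]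
    linarith
  calc ∑ i, RCLike.re (inner 𝕜 (u i) (T (v i)))
      ≤ ∑ i, ∑ j : Fin (finrank 𝕜 E), T.singularValues j *
          ((‖inner 𝕜 (u i) (leftSingularVector T j)‖ ^ 2 +
            ‖inner 𝕜 (v i) (rightSingularBasis T j)‖ ^ 2) / 2) :=
        Finset.sum_le_sum fun i _ => re_inner_apply_le_sum T (u i) (v i)
    _ = ∑ j : Fin (finrank 𝕜 E), T.singularValues j * w j := by
        rw [Finset.sum_comm]
        simp only [w, Finset.mul_sum]
    _ ≤ kyFanNorm k T := sum_mul_le_sum_range_of_antitone T.singularValues_antitone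
        (T.singularValues_nonneg k) hw_nonneg hw_le_one hw_sum

theorem kyFanNorm_eq_kyFanNorm_min_finrank (k : ℕ) (T : E →ₗ[𝕜] F) :
    kyFanNorm k T = kyFanNorm (min k (finrank 𝕜 E)) T := by
  refine (Finset.sum_subset (Finset.range_mono (min_le_left _ _)) fun i hik hi => ?_).symm
  simp only [Finset.mem_range] at hik hi
  exact T.singularValues_of_finrank_le (by omega)

theorem exists_kyFanNorm_eq_sum_re_inner (k : ℕ) (T : E →ₗ[𝕜] F) :
    ∃ (u : Fin (min k (finrank 𝕜 E)) → F) (v : Fin (min k (finrank 𝕜 E)) → E),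
      IsBesselFamily 𝕜 u ∧ IsBesselFamily 𝕜 v ∧
        kyFanNorm k T = ∑ i, RCLike.re (inner 𝕜 (u i) (T (v i))) := by
  have hcast := Fin.castLE_injective (min_le_right k (finrank 𝕜 E))
  refine ⟨leftSingularVector T ∘ Fin.castLE _, rightSingularBasis T ∘ Fin.castLE _,
    (isBesselFamily_leftSingularVector T).comp hcast,
    (IsBesselFamily.of_orthonormal (rightSingularBasis T).orthonormal).comp hcast, ?_⟩
  simp only [Function.comp_apply, inner_leftSingularVector_apply_rightSingularBasis,
    RCLike.ofReal_re, Fin.val_castLE]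
  rw [kyFanNorm_eq_kyFanNorm_min_finrank, kyFanNorm, Finset.sum_range]

theorem kyFanNorm_smul_add_smul_le (k : ℕ) {a b : ℝ} (ha : 0 ≤ a) (hb : 0 ≤ b)
    (S T : E →ₗ[𝕜] F) :
    kyFanNorm k ((a : 𝕜) • S + (b : 𝕜) • T) ≤ a * kyFanNorm k S + b * kyFanNorm k T := by
  obtain ⟨u, v, hu, hv, heq⟩ := exists_kyFanNorm_eq_sum_re_inner k ((a : 𝕜) • S + (b : 𝕜) • T)
  have hcard : Fintype.card (Fin (min k (finrank 𝕜 E))) ≤ k := by simp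
  calc kyFanNorm k ((a : 𝕜) • S + (b : 𝕜) • T)
      = a * ∑ i, RCLike.re (inner 𝕜 (u i) (S (v i))) +
          b * ∑ i, RCLike.re (inner 𝕜 (u i) (T (v i))) := by
        simp only [heq, LinearMap.add_apply, LinearMap.smul_apply, inner_add_right,
          inner_smul_right, map_add, RCLike.re_ofReal_mul, Finset.sum_add_distrib, Finset.mul_sum]
    _ ≤ a * kyFanNorm k S + b * kyFanNorm k T := by
        gcongr
        · exact sum_re_inner_le_kyFanNorm hcard hu hv S
        · exact sum_re_inner_le_kyFanNorm hcard hu hv T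

theorem kyFanNorm_le_nsmul_opNorm (k : ℕ) (T : E →L[𝕜] F) :
    kyFanNorm k (T : E →ₗ[𝕜] F) ≤ k * ‖T‖ := by
  obtain ⟨u, v, hu, hv, heq⟩ := exists_kyFanNorm_eq_sum_re_inner k (T : E →ₗ[𝕜] F)
  have hterm (i) : RCLike.re (inner 𝕜 (u i) (T (v i))) ≤ ‖T‖ :=
    calc RCLike.re (inner 𝕜 (u i) (T (v i)))
        ≤ ‖u i‖ * ‖T (v i)‖ := re_inner_le_norm _ _
      _ ≤ 1 * (‖T‖ * 1) := by
        gcongr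
        · exact hu.norm_le_one i
        · exact T.le_opNorm_of_le (hv.norm_le_one i) |>.trans_eq (by ring)
      _ = ‖T‖ := by ring
  calc kyFanNorm k (T : E →ₗ[𝕜] F)
      ≤ (min k (finrank 𝕜 E) : ℕ) * ‖T‖ := by
        rw [heq]
        exact (Finset.sum_le_card_nsmul _ _ _ fun i _ => hterm i).trans_eq (by simp)
    _ ≤ k * ‖T‖ := by
        gcongr
        exact min_le_left _ _

theorem opNorm_le_singularValues_zero (T : E →L[𝕜] F) :
    ‖T‖ ≤ (T : E →ₗ[𝕜] F).singularValues 0 := by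
  refine T.opNorm_le_of_re_inner_le ((T : E →ₗ[𝕜] F).singularValues_nonneg 0) fun x y hx hy => ?_
  have h := sum_re_inner_le_kyFanNorm (ι := Unit) (k := 1) (by simp)
    (.of_subsingleton fun _ => hy.le) (.of_subsingleton fun _ => hx.le) (T : E →ₗ[𝕜] F)
  rw [inner_re_symm]
  simpa [kyFanNorm] using h

theorem continuous_kyFanNorm (k : ℕ) :
    Continuous fun T : E →L[𝕜] F => kyFanNorm k (T : E →ₗ[𝕜] F) := by
  refine (LipschitzWith.of_le_add_mul k fun S T => ?_).continuous
  have hadd := kyFanNorm_smul_add_smul_le k zero_le_one zero_le_one (T : E →ₗ[𝕜] F)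
    ((S - T : E →L[𝕜] F) : E →ₗ[𝕜] F)
  have hsub := kyFanNorm_le_nsmul_opNorm k (S - T)
  simp only [RCLike.ofReal_one, one_smul, one_mul, ContinuousLinearMap.toLinearMap_sub,
    add_sub_cancel] at hadd hsub
  rw [dist_eq_norm]
  exact hadd.trans (by simpa using hsub)

theorem continuous_singularValues (i : ℕ) :
    Continuous fun T : E →L[𝕜] F => (T : E →ₗ[𝕜] F).singularValues i := by
  refine ((continuous_kyFanNorm (i + 1)).sub (continuous_kyFanNorm i)).congr fun T => ?_
  simp only [Pi.sub_apply, kyFanNorm, Finset.sum_range_succ_sub_sum]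

end KyFan

theorem apply_eq_of_toLex_le_of_le {ι α : Type*} [LinearOrder ι] [WellFoundedLT ι] [LinearOrder α]
    {x y : ι → α} (h : toLex x ≤ toLex y) {i : ι} (hle : ∀ j ≤ i, y j ≤ x j) : x i = y i := by
  induction i using WellFoundedLT.induction with
  | ind i ih =>
    have heq : ∀ j < i, x j = y j := fun j hj => ih j hj fun k hk => hle k (hk.trans hj.le)
    exact (Pi.apply_le_of_toLex h heq).antisymm (hle i le_rfl)

section Matrix

open Matrix

variable {m n : ℕ}

theorem isClosedEmbedding_toContinuousLinearMap_toEuclideanLin :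
    IsClosedEmbedding fun A : Matrix (Fin m) (Fin n) ℂ =>
      (toEuclideanLin A).toContinuousLinearMap := by
  let Φ : Matrix (Fin m) (Fin n) ℂ ≃ₗ[ℂ]
      (EuclideanSpace ℂ (Fin n) →L[ℂ] EuclideanSpace ℂ (Fin m)) :=
    toEuclideanLin.trans LinearMap.toContinuousLinearMap
  exact LinearMap.isClosedEmbedding_of_injective (f := Φ.toLinearMap) Φ.ker

theorem continuous_singularValues_toEuclideanLin (i : ℕ) :
    Continuous fun A : Matrix (Fin m) (Fin n) ℂ => (toEuclideanLin A).singularValues i := by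
  have hcomp := (continuous_singularValues (𝕜 := ℂ) (E := EuclideanSpace ℂ (Fin n))
    (F := EuclideanSpace ℂ (Fin m)) i).comp
    isClosedEmbedding_toContinuousLinearMap_toEuclideanLin.continuous
  exact hcomp.congr fun A => by
    simp only [Function.comp_apply, LinearMap.coe_toContinuousLinearMap]

theorem isCompact_setOf_singularValues_zero_le (C : ℝ) :
    IsCompact {A : Matrix (Fin m) (Fin n) ℂ | (toEuclideanLin A).singularValues 0 ≤ C} := by
  have : ProperSpace (EuclideanSpace ℂ (Fin n) →L[ℂ] EuclideanSpace ℂ (Fin m)) :=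
    FiniteDimensional.proper ℂ _
  refine (isClosedEmbedding_toContinuousLinearMap_toEuclideanLin.isCompact_preimage
    (isCompact_closedBall 0 C)).of_isClosed_subset
      (isClosed_le (continuous_singularValues_toEuclideanLin 0) continuous_const) fun A hA => ?_
  rw [Set.mem_preimage, mem_closedBall_zero_iff]
  exact (opNorm_le_singularValues_zero _).trans hA

theorem singularValueVec_nonneg (A : Matrix (Fin m) (Fin n) ℂ) (i : Fin (min m n)) :
    0 ≤ A.singularValueVec i :=
  (toEuclideanLin A).singularValues_nonneg i

theorem singularValueVec_antitone (A : Matrix (Fin m) (Fin n) ℂ) : Antitone A.singularValueVec :=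
  fun _ _ h => (toEuclideanLin A).singularValues_antitone h

theorem sum_singularValueVec_rpow_le_of_schattenNorm_le {A B : Matrix (Fin m) (Fin n) ℂ} {p : ℝ}
    (hp : 0 < p) (h : schattenNorm p A ≤ schattenNorm p B) :
    ∑ i, A.singularValueVec i ^ p ≤ ∑ i, B.singularValueVec i ^ p := by
  have hsum_nonneg (C : Matrix (Fin m) (Fin n) ℂ) : 0 ≤ ∑ i, C.singularValueVec i ^ p :=
    Finset.sum_nonneg fun i _ => Real.rpow_nonneg (singularValueVec_nonneg C i) p
  exact (Real.rpow_le_rpow_iff (hsum_nonneg A) (hsum_nonneg B) (one_div_pos.2 hp)).1 h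

theorem sum_singularValueVec_rpow_segment_le (S T : Matrix (Fin m) (Fin n) ℂ) {p t : ℝ}
    (hp : 1 ≤ p) (ht : t ∈ Set.Icc (0 : ℝ) 1) :
    ∑ i, ((1 - t) • S + t • T).singularValueVec i ^ p ≤
      ∑ i, ((1 - t) * S.singularValueVec i + t * T.singularValueVec i) ^ p := by
  have ht' : 0 ≤ 1 - t := sub_nonneg.2 ht.2
  have hlin : toEuclideanLin ((1 - t) • S + t • T) =
      ((1 - t : ℝ) : ℂ) • toEuclideanLin S + (t : ℂ) • toEuclideanLin T := by
    rw [← Complex.coe_smul, ← Complex.coe_smul, map_add, map_smul, map_smul]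
  simp only [singularValueVec]
  rw [Fin.sum_univ_eq_sum_range
      (fun i => (toEuclideanLin ((1 - t) • S + t • T)).singularValues i ^ p),
    Fin.sum_univ_eq_sum_range (fun i => ((1 - t) * (toEuclideanLin S).singularValues i +
      t * (toEuclideanLin T).singularValues i) ^ p)]
  refine sum_rpow_le_sum_rpow_of_partial_sums_le (fun i => ?_)
    (LinearMap.singularValues_antitone _) (LinearMap.singularValues_nonneg _) hp fun k _ => ?_
  · have hS := (toEuclideanLin S).singularValues_nonneg i
    have hT := (toEuclideanLin T).singularValues_nonneg i
    have := ht.1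
    positivity
  · rw [hlin, Finset.sum_add_distrib, ← Finset.mul_sum, ← Finset.mul_sum]
    exact kyFanNorm_smul_add_smul_le k ht' ht.1 _ _

theorem sum_rpow_sub_one_mul_sub_nonneg_of_isMinOn_schattenNorm
    {M : Set (Matrix (Fin m) (Fin n) ℂ)} (hM : Convex ℝ M) {A X Y : Matrix (Fin m) (Fin n) ℂ}
    {p : ℝ} (hp : 1 ≤ p) (hX : X ∈ M) (hY : Y ∈ M)
    (hmin : IsMinOn (fun Z => schattenNorm p (A - Z)) M Y) :
    0 ≤ ∑ i, (A - Y).singularValueVec i ^ (p - 1) *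
      ((A - X).singularValueVec i - (A - Y).singularValueVec i) := by
  refine sum_rpow_sub_one_mul_sub_nonneg_of_segment hp fun t ht => ?_
  have hZ : (1 - t) • Y + t • X ∈ M := hM hY hX (sub_nonneg.2 ht.2) ht.1 (sub_add_cancel 1 t)
  have hsub : A - ((1 - t) • Y + t • X) = (1 - t) • (A - Y) + t • (A - X) := by module
  calc ∑ i, (A - Y).singularValueVec i ^ p
      ≤ ∑ i, (A - ((1 - t) • Y + t • X)).singularValueVec i ^ p :=
        sum_singularValueVec_rpow_le_of_schattenNorm_le (by linarith) (hmin hZ)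
    _ ≤ ∑ i, ((1 - t) * (A - Y).singularValueVec i + t * (A - X).singularValueVec i) ^ p := by
        rw [hsub]
        exact sum_singularValueVec_rpow_segment_le _ _ hp ht

section LimitOfApproximations

variable {M : Set (Matrix (Fin m) (Fin n) ℂ)} {A Yst : Matrix (Fin m) (Fin n) ℂ}
  {Y : ℝ → Matrix (Fin m) (Fin n) ℂ}

theorem eventually_singularValueVec_lt_add (hM : Convex ℝ M) (hYst : Yst ∈ M)
    (hlex : ∀ X ∈ M, toLex (A - Yst).singularValueVec ≤ toLex (A - X).singularValueVec)
    (hY : ∀ᶠ p in atTop, Y p ∈ M ∧ IsMinOn (fun X => schattenNorm p (A - X)) M (Y p))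
    {i : Fin (min m n)}
    (hi : ∀ j, (A - Yst).singularValueVec i < (A - Yst).singularValueVec j → (j : ℕ) = 0)
    {ε : ℝ} (hε : 0 < ε) :
    ∀ᶠ p in atTop, (A - Y p).singularValueVec i < (A - Yst).singularValueVec i + ε := by
  refine eventually_lt_add_of_sum_rpow_sub_one_mul_sub_nonneg
    (fun p => singularValueVec_nonneg (A - Y p)) (singularValueVec_nonneg _) (Finset.mem_univ i)
    ?_ ?_ hε
  · filter_upwards [hY] with p hp j _ hij
    refine Pi.apply_le_of_toLex (hlex _ hp.1) fun k hk => absurd (Fin.lt_def.1 hk) ?_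
    rw [hi j hij]
    exact Nat.not_lt_zero _
  · filter_upwards [hY, eventually_ge_atTop 1] with p hYp hp
    exact sum_rpow_sub_one_mul_sub_nonneg_of_isMinOn_schattenNorm hM hp hYst hYp.1 hYp.2

theorem mainTheorem5_general (hM : Convex ℝ M) (hMc : IsClosed M) (hYst : Yst ∈ M)
    (hlex : ∀ X ∈ M, toLex (A - Yst).singularValueVec ≤ toLex (A - X).singularValueVec)
    (hY : ∀ᶠ p in atTop, Y p ∈ M ∧ IsMinOn (fun X => schattenNorm p (A - X)) M (Y p))
    {i : Fin (min m n)}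
    (hi : ∀ j, (A - Yst).singularValueVec i < (A - Yst).singularValueVec j → (j : ℕ) = 0) :
    Tendsto (fun p => (A - Y p).singularValueVec i) atTop
      (𝓝 ((A - Yst).singularValueVec i)) := by
  have hlt : ∀ j ≤ i, ∀ ε > 0, ∀ᶠ p in atTop,
      (A - Y p).singularValueVec j < (A - Yst).singularValueVec j + ε := fun j hj ε hε =>
    eventually_singularValueVec_lt_add hM hYst hlex hY
      (fun l hl => hi l ((singularValueVec_antitone _ hj).trans_lt hl)) hε
  rw [tendsto_iff_ultrafilter]
  intro g hg
  let i₀ : Fin (min m n) := ⟨0, i.pos⟩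
  obtain ⟨R, -, hR : Tendsto (fun p => A - Y p) g (𝓝 R)⟩ :=
    (isCompact_setOf_singularValues_zero_le ((A - Yst).singularValueVec i₀ + 1)).ultrafilter_le_nhds
      (g.map fun p => A - Y p) (le_principal_iff.2 <|
        ((hlt i₀ (Nat.zero_le i) 1 one_pos).filter_mono hg).mono fun p hp => hp.le)
  have hRM : A - R ∈ M := by
    refine hMc.mem_of_tendsto (f := Y) (b := (g : Filter ℝ)) ?_ (hg (hY.mono fun p hp => hp.1))
    simpa only [sub_sub_cancel] using hR.const_sub A
  have hσ (j : Fin (min m n)) :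
      Tendsto (fun p => (A - Y p).singularValueVec j) g (𝓝 (R.singularValueVec j)) :=
    ((continuous_singularValues_toEuclideanLin j).tendsto R).comp hR
  have hR_le : ∀ j ≤ i, R.singularValueVec j ≤ (A - Yst).singularValueVec j := fun j hj =>
    le_of_forall_pos_le_add fun ε hε =>
      le_of_tendsto (hσ j) (hg ((hlt j hj ε hε).mono fun p hp => hp.le))
  have hlexR := hlex _ hRM
  rw [sub_sub_cancel] at hlexR
  rw [apply_eq_of_toLex_le_of_le hlexR hR_le]
  exact hσ i

end LimitOfApproximations

end Matrix

section DistinctSingularValues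

variable {m n : ℕ} {R : Matrix (Fin m) (Fin n) ℂ}

theorem rho_strictAnti (R : Matrix (Fin m) (Fin n) ℂ) : StrictAnti R.rho := fun _ _ h =>
  (R.distinctSingularValues.orderEmbOfFin rfl).strictMono (Fin.rev_lt_rev.2 h)

theorem exists_singularValueVec_eq_rho (R : Matrix (Fin m) (Fin n) ℂ) (i : Fin (min m n)) :
    ∃ j, R.singularValueVec i = R.rho j := by
  have hmem : R.singularValueVec i ∈ R.distinctSingularValues :=
    Finset.mem_image_of_mem _ (Finset.mem_univ i)
  rw [← Finset.mem_coe, ← Finset.range_orderEmbOfFin R.distinctSingularValues rfl] at hmem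
  obtain ⟨j, hj⟩ := hmem
  exact ⟨j.rev, ((congrArg _ (Fin.rev_rev j)).trans hj).symm⟩

theorem rhoMultSum_eq_card (R : Matrix (Fin m) (Fin n) ℂ) (k : ℕ) :
    R.rhoMultSum k = (Finset.univ.filter fun i =>
      ∃ j : Fin R.numDistinct, (j : ℕ) < k ∧ R.singularValueVec i = R.rho j).card := by
  simp only [Matrix.rhoMultSum, Matrix.rhoMult]
  rw [← Finset.card_biUnion]
  · congr 1
    ext i
    simp
  · intro j _ j' _ hne
    refine Finset.disjoint_filter.2 fun i _ hj hj' => hne ((rho_strictAnti R).injective ?_)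
    rw [← hj, hj']

theorem lt_rhoMultSum_iff {k : ℕ} {i : Fin (min m n)} :
    (i : ℕ) < R.rhoMultSum k ↔
      ∃ j : Fin R.numDistinct, (j : ℕ) < k ∧ R.singularValueVec i = R.rho j := by
  rw [rhoMultSum_eq_card]
  refine Fin.lt_card_filter_univ_iff_apply_of_imp _ fun i' i hii' => ?_
  rintro ⟨j', hj', hi'⟩
  obtain ⟨j, hj⟩ := exists_singularValueVec_eq_rho R i
  have hrho : R.rho j' ≤ R.rho j := hi' ▸ hj ▸ singularValueVec_antitone R hii'
  exact ⟨j, (Fin.le_def.1 ((rho_strictAnti R).le_iff_ge.1 hrho)).trans_lt hj', hj⟩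

theorem singularValueVec_eq_rho {k : ℕ} (hk : k < R.numDistinct) {i : Fin (min m n)}
    (h₁ : R.rhoMultSum k ≤ i) (h₂ : (i : ℕ) < R.rhoMultSum (k + 1)) :
    R.singularValueVec i = R.rho ⟨k, hk⟩ := by
  obtain ⟨j, hjk, hj⟩ := lt_rhoMultSum_iff.1 h₂
  have hkj : ¬ (j : ℕ) < k := fun h => h₁.not_gt (lt_rhoMultSum_iff.2 ⟨j, h, hj⟩)
  rw [hj, show j = ⟨k, hk⟩ from Fin.ext (by dsimp; omega)]

theorem lt_rhoMultSum_of_singularValueVec_lt {k : ℕ} {i j : Fin (min m n)}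
    (hi : (i : ℕ) < R.rhoMultSum (k + 1)) (hij : R.singularValueVec i < R.singularValueVec j) :
    (j : ℕ) < R.rhoMultSum k := by
  obtain ⟨a, hak, ha⟩ := lt_rhoMultSum_iff.1 hi
  obtain ⟨b, hb⟩ := exists_singularValueVec_eq_rho R j
  rw [ha, hb, (rho_strictAnti R).lt_iff_gt] at hij
  exact lt_rhoMultSum_iff.2 ⟨b, (Fin.lt_def.1 hij).trans_le (Nat.lt_succ_iff.1 hak), hb⟩

theorem rhoMultSum_one (h : 0 < R.numDistinct) : R.rhoMultSum 1 = R.rhoMult ⟨0, h⟩ := by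
  rw [Matrix.rhoMultSum, Finset.sum_eq_single_of_mem ⟨0, h⟩ (by simp)]
  intro j hj hne
  exact (hne (Fin.ext (by simpa using hj))).elim

end DistinctSingularValues

theorem mainTheorem5 {m n : ℕ} (M : Submodule ℝ (Matrix (Fin m) (Fin n) ℂ))
    (A Yst : Matrix (Fin m) (Fin n) ℂ) (Y : ℝ → Matrix (Fin m) (Fin n) ℂ)
    (hYst : Matrix.IsStrictSpectralApprox M A Yst)
    (hY : ∀ p : ℝ, 1 < p → Matrix.IsSchattenApprox p M A (Y p))
    (hl : 1 < (A - Yst).numDistinct)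
    (hs : (A - Yst).rhoMult ⟨0, zero_lt_one.trans hl⟩ = 1) :
    ∀ i : Fin (min m n), (A - Yst).rhoMultSum 1 ≤ (i : ℕ) → (i : ℕ) < (A - Yst).rhoMultSum 2 →
      Tendsto (fun p : ℝ => (A - Y p).singularValueVec i) atTop
          (𝓝 ((A - Yst).singularValueVec i)) ∧
        (A - Yst).singularValueVec i = (A - Yst).rho ⟨1, hl⟩ := by
  intro i hi₁ hi₂
  refine ⟨mainTheorem5_general M.convex M.closed_of_finiteDimensional hYst.1 hYst.2
    ((eventually_gt_atTop 1).mono fun p hp => ⟨(hY p hp).1, isMinOn_iff.2 (hY p hp).2⟩)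
    fun j hij => ?_, singularValueVec_eq_rho hl hi₁ hi₂⟩
  have hj := lt_rhoMultSum_of_singularValueVec_lt hi₂ hij
  rwa [rhoMultSum_one (zero_lt_one.trans hl), hs, Nat.lt_one_iff] at hj
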